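/- Let $F$ be a field, let $L=\{\alpha_1,\dotsc,\alpha_k\}\subset F$ be a finite set, and assume $0\notin L$. An $L$-matrix is a square matrix over $F$ whose diagonal entries are all $0$ and whose off-diagonal entries all belong to $L$. For an integer $r\ge 0$ let $N(r,L)$ be the maximum $n$ such that there is an $n\times n$ $L$-matrix of rank at most $r$. Then the following three statements are equivalent: (a) $N(r-1,L)\geq r+1$ for some integer $r\ge 1$; (b) there is a homogeneous polynomial $P\in\mathbb{Z}[x_1,\dotsc,x_k]$ such that $P(1,\dotsc,1)=1$ and $P(\alpha_1,\dotsc,\alpha_k)=0$; (c) there is a real constant $c>1$, which may depend on $L$, such that $N(r,L)\geq cr$ for all sufficiently large integers $r$. Furthermore, whether or not these statements hold, the limit $\lim_{r\to\infty} N(r,L)/r$ exists in $[0,\infty]$. -/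

import Mathlib

open Filter Topology
open scoped ENNReal NNReal

/-- An `L`-matrix: every diagonal entry is zero and every off-diagonal entry belongs to `L`. -/
def IsLMatrix {F : Type*} [Field F] (L : Set F) {n : ℕ} (M : Matrix (Fin n) (Fin n) F) : Prop :=
  (∀ i, M i i = 0) ∧ ∀ i j, i ≠ j → M i j ∈ L

/-- `maxLSize r L` is the maximum of all `n` for which an `n`-by-`n` `L`-matrix of rank at most `r`
exists. It is the supremum in `ℕ∞` of a nonempty set of natural numbers (it contains `0`): if that
set is bounded, the supremum is its maximum, and otherwise the value is `⊤`. -/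
noncomputable def maxLSize {F : Type*} [Field F] (r : ℕ) (L : Set F) : ℕ∞ :=
  ⨆ n ∈ {n : ℕ | ∃ M : Matrix (Fin n) (Fin n) F, IsLMatrix L M ∧ M.rank ≤ r}, (n : ℕ∞)

/-! Write N(r) for `maxLSize r L` and J for the all-ones matrix. If M is an L-matrix, a ∈ L and M -
aJ has rank at most s, then q diagonal copies of M - aJ, plus aJ, form an L-matrix q times as large,
of rank at most qs + 1 (`mul_card_le_maxLSize`). Taking s = m + 1 bounds liminf N(r)/r below by
N(m)/(m+1) for every m, which gives both the limit and (a) → (c).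

(a) → (b): a singular L-matrix is a specialization of a generic one, whose determinant is a form
vanishing at α. An L-matrix of corank 2 and a principal submatrix one size smaller are both
singular; the values of their forms at (1,...,1) are, up to sign, consecutive integers, so a Bézout
combination takes the value 1.

(b) → (a): put y_i = α_i/a - 1 and let V be the ℤ-span of the y_i. Expanding P(1+y) = 0 around P(1)
= 1 puts 1 in V(1+V)^n, so the finitely generated group S = (1+V)^n satisfies S ⊆ VS. Generators of
S form a fixed vector of a matrix over V. Enlarging it gives a matrix B with zero diagonal, entries
in {0, y_i} and a nonzero fixed vector. Then a(B - I) is singular and equals A - aJ for an L-matrix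
A; three copies of A suffice. -/

section Rank

variable {F : Type*} [Field F]

lemma Matrix.rank_add_le_add {m n : Type*} [Fintype m] [Fintype n] (A B : Matrix m n F) :
    (A + B).rank ≤ A.rank + B.rank := by
  unfold Matrix.rank
  rw [Matrix.mulVecLin_add]
  refine (Submodule.finrank_mono ?_).trans
    (Submodule.finrank_add_le_finrank_add_finrank (LinearMap.range A.mulVecLin)
      (LinearMap.range B.mulVecLin))
  rintro _ ⟨v, rfl⟩
  exact Submodule.add_mem_sup ⟨v, rfl⟩ ⟨v, rfl⟩

lemma Matrix.rank_sum_le_card_mul {m n ι : Type*} [Fintype m] [Fintype n] (t : Finset ι)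
    (A : ι → Matrix m n F) (s : ℕ) (h : ∀ i ∈ t, (A i).rank ≤ s) :
    (∑ i ∈ t, A i).rank ≤ t.card * s := by
  classical
  induction t using Finset.induction_on with
  | empty => simp
  | insert a t ha ih =>
    rw [Finset.sum_insert ha, Finset.card_insert_of_notMem ha, add_mul, one_mul, add_comm (A a)]
    exact (Matrix.rank_add_le_add _ _).trans
      (add_le_add (ih fun i hi => h i (Finset.mem_insert_of_mem hi))
        (h a (Finset.mem_insert_self a t)))

lemma Matrix.rank_of_ite_le {ι n : Type*} [Fintype ι] [DecidableEq ι] [Fintype n]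
    (A : Matrix n n F) :
    (Matrix.of fun x y : ι × n => if x.1 = y.1 then A x.2 y.2 else 0).rank ≤
      Fintype.card ι * A.rank := by
  classical
  have key : (Matrix.of fun x y : ι × n => if x.1 = y.1 then A x.2 y.2 else 0) =
      ∑ b : ι, Matrix.diagonal (fun x : ι × n => if x.1 = b then (1 : F) else 0) *
        A.submatrix Prod.snd Prod.snd *
        Matrix.diagonal (fun x : ι × n => if x.1 = b then (1 : F) else 0) := by
    ext x y
    simp only [Matrix.of_apply, Matrix.sum_apply, Matrix.mul_diagonal, Matrix.diagonal_mul,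
      Matrix.submatrix_apply]
    rw [Finset.sum_eq_single x.1]
    · simp [eq_comm]
    · intro b _ hb
      simp [hb.symm]
    · simp
  rw [key]
  refine Matrix.rank_sum_le_card_mul _ _ _ fun b _ => ?_
  exact (Matrix.rank_mul_le_left _ _).trans
    ((Matrix.rank_mul_le_right _ _).trans (Matrix.rank_submatrix_le _ _ _))

lemma Matrix.rank_const_le {m n : Type*} [Fintype m] [Fintype n] (a : F) :
    (Matrix.of fun (_ : m) (_ : n) => a).rank ≤ 1 := by
  have : (Matrix.of fun (_ : m) (_ : n) => a) = Matrix.vecMulVec (fun _ => a) (fun _ => 1) := by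
    ext; simp [Matrix.vecMulVec_apply]
  rw [this]
  exact Matrix.rank_vecMulVec_le _ _

lemma Matrix.rank_lt_card_of_mulVec_eq_zero {n : Type*} [Fintype n] (A : Matrix n n F)
    {v : n → F} (hv : v ≠ 0) (h : A.mulVec v = 0) : A.rank < Fintype.card n := by
  classical
  refine lt_of_le_of_ne (Matrix.rank_le_card_width A) fun hr => ?_
  have hdet : A.det = 0 := Matrix.exists_mulVec_eq_zero_iff.mp ⟨v, hv, h⟩
  have hker := LinearMap.finrank_range_add_finrank_ker A.mulVecLin
  have hr' : Module.finrank F (LinearMap.range A.mulVecLin) = Fintype.card n := hr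
  rw [hr', Module.finrank_fintype_fun_eq_card] at hker
  have h0 : LinearMap.ker A.mulVecLin = ⊥ := Submodule.finrank_eq_zero.mp (by omega)
  have : v ∈ LinearMap.ker A.mulVecLin := by simpa using h
  rw [h0] at this
  exact hv (by simpa using this)

lemma Matrix.det_eq_zero_of_rank_lt {n : Type*} [Fintype n] [DecidableEq n] (A : Matrix n n F)
    (h : A.rank < Fintype.card n) : A.det = 0 := by
  by_contra hd
  exact h.ne (Matrix.rank_of_isUnit A ((Matrix.isUnit_iff_isUnit_det A).mpr (Ne.isUnit hd)))

end Rank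

/-! ### Block constructions and lower bounds for the maximal size. -/

section MaxSize

variable {F : Type*} [Field F] {L : Set F}

lemma card_le_maxLSize {ι : Type*} [Fintype ι] {r : ℕ} (M : Matrix ι ι F)
    (hd : ∀ i, M i i = 0) (ho : ∀ i j, i ≠ j → M i j ∈ L) (hr : M.rank ≤ r) :
    (Fintype.card ι : ℕ∞) ≤ maxLSize r L := by
  classical
  let e := (Fintype.equivFin ι).symm
  refine le_iSup₂_of_le (Fintype.card ι) ⟨M.submatrix e e, ⟨fun i => hd _, fun i j hij =>
    ho _ _ (e.injective.ne hij)⟩, ?_⟩ le_rfl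
  exact (Matrix.rank_submatrix_le M e e).trans hr

/-- Principal submatrices keep the L-property and do not raise the rank, so the attained sizes are
downward closed, also when the supremum is `⊤`. -/
lemma exists_isLMatrix_of_le_maxLSize {n r : ℕ} (h : (n : ℕ∞) ≤ maxLSize r L) :
    ∃ M : Matrix (Fin n) (Fin n) F, IsLMatrix L M ∧ M.rank ≤ r := by
  obtain _ | n := n
  · exact ⟨0, ⟨fun i => i.elim0, fun i => i.elim0⟩, by simp⟩
  have h' : (n : ℕ∞) < maxLSize r L := lt_of_lt_of_le (by exact_mod_cast Nat.lt_succ_self n) h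
  unfold maxLSize at h'
  simp only [lt_iSup_iff] at h'
  obtain ⟨m, ⟨M, hM, hr⟩, hnm⟩ := h'
  have hnm' : n + 1 ≤ m := by exact_mod_cast hnm
  let e := Fin.castLE hnm'
  exact ⟨M.submatrix e e, ⟨fun i => hM.1 _, fun i j hij =>
    hM.2 _ _ ((Fin.castLE_injective hnm').ne hij)⟩, (Matrix.rank_submatrix_le M e e).trans hr⟩

lemma mul_card_le_maxLSize {ι : Type*} [Fintype ι] {s : ℕ} {a : F} (ha : a ∈ L)
    (M : Matrix ι ι F) (hd : ∀ i, M i i = 0) (ho : ∀ i j, i ≠ j → M i j ∈ L)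
    (hr : (M - Matrix.of fun _ _ => a).rank ≤ s) (q : ℕ) :
    ((q * Fintype.card ι : ℕ) : ℕ∞) ≤ maxLSize (q * s + 1) L := by
  classical
  set A : Matrix ι ι F := M - Matrix.of fun _ _ => a with hA
  have hAa : ∀ i j, A i j + a = M i j := fun i j => by simp [hA]
  have := card_le_maxLSize (L := L) (r := q * s + 1) (ι := Fin q × ι)
    ((Matrix.of fun x y : Fin q × ι => if x.1 = y.1 then A x.2 y.2 else 0) +
      Matrix.of fun _ _ => a)
    (fun i => by simp [hAa, hd]) (fun i j hij => ?_) ?_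
  · simpa using this
  · by_cases h : i.1 = j.1
    · have h2 : i.2 ≠ j.2 := fun h2 => hij (Prod.ext h h2)
      simpa [h, hAa] using ho _ _ h2
    · simpa [h] using ha
  · refine (Matrix.rank_add_le_add _ _).trans (add_le_add ?_ (Matrix.rank_const_le a))
    refine (Matrix.rank_of_ite_le _).trans ?_
    rw [Fintype.card_fin]
    exact Nat.mul_le_mul_left q hr

lemma mul_le_maxLSize {n m : ℕ} (hL : L.Nonempty) (h : (n : ℕ∞) ≤ maxLSize m L) (q : ℕ) :
    ((q * n : ℕ) : ℕ∞) ≤ maxLSize (q * (m + 1) + 1) L := by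
  obtain ⟨a, ha⟩ := hL
  obtain ⟨M, hM, hr⟩ := exists_isLMatrix_of_le_maxLSize h
  have := mul_card_le_maxLSize (s := m + 1) ha M hM.1 hM.2 ?_ q
  · simpa using this
  · have : M - (Matrix.of fun _ _ => a) = M + Matrix.of fun _ _ => -a := by
      ext; simp [sub_eq_add_neg]
    rw [this]
    exact (Matrix.rank_add_le_add _ _).trans (add_le_add hr (Matrix.rank_const_le _))

lemma maxLSize_mono {r s : ℕ} (h : r ≤ s) : maxLSize r L ≤ maxLSize s L :=
  iSup₂_le fun n ⟨M, hM, hr⟩ => le_iSup₂_of_le n ⟨M, hM, hr.trans h⟩ le_rfl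

lemma maxLSize_empty_le (r : ℕ) : maxLSize r (∅ : Set F) ≤ 1 := by
  refine iSup₂_le fun n ⟨M, hM, _⟩ => ?_
  by_contra! h
  have h1 : 1 < n := by exact_mod_cast h
  exact hM.2 ⟨0, by omega⟩ ⟨1, h1⟩ (by simp)

end MaxSize

/-! ### The limit of N(r)/r and its link with corank 2. -/

section Limit

variable {F : Type*} [Field F] {L : Set F}

lemma div_le_liminf_maxLSize_div (hL : L.Nonempty) (m : ℕ) :
    ((maxLSize m L : ℕ∞) : ℝ≥0∞) / ((m + 1 : ℕ) : ℝ≥0∞) ≤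
      liminf (fun r : ℕ => ((maxLSize r L : ℕ∞) : ℝ≥0∞) / (r : ℝ≥0∞)) atTop := by
  have hm0 : ((m + 1 : ℕ) : ℝ≥0∞) ≠ 0 := by exact_mod_cast m.succ_ne_zero
  have hmt : ((m + 1 : ℕ) : ℝ≥0∞) ≠ ⊤ := ENNReal.natCast_ne_top _
  have key : ∀ n : ℕ, (n : ℕ∞) ≤ maxLSize m L → (n : ℝ≥0∞) / ((m + 1 : ℕ) : ℝ≥0∞) ≤
      liminf (fun r : ℕ => ((maxLSize r L : ℕ∞) : ℝ≥0∞) / (r : ℝ≥0∞)) atTop := by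
    intro n hn
    have hlim : Tendsto (fun r : ℕ => (n : ℝ≥0∞) / ((m + 1 : ℕ) : ℝ≥0∞) -
        ((2 * n : ℕ) : ℝ≥0∞) / (r : ℝ≥0∞)) atTop (𝓝 ((n : ℝ≥0∞) / ((m + 1 : ℕ) : ℝ≥0∞) - 0)) := by
      refine ENNReal.Tendsto.sub tendsto_const_nhds ?_ (Or.inr ENNReal.zero_ne_top)
      have := ENNReal.Tendsto.const_div (a := ((2 * n : ℕ) : ℝ≥0∞)) ENNReal.tendsto_nat_nhds_top
        (Or.inr (ENNReal.natCast_ne_top _))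
      rwa [ENNReal.div_top] at this
    rw [tsub_zero] at hlim
    rw [← hlim.liminf_eq]
    refine liminf_le_liminf ?_
    filter_upwards [eventually_ge_atTop 1] with r hr
    have hr0 : (r : ℝ≥0∞) ≠ 0 := by exact_mod_cast (by omega : r ≠ 0)
    rw [tsub_le_iff_right, ← ENNReal.add_div, ENNReal.div_le_iff hm0 hmt,
      mul_comm, ← mul_div_assoc, mul_comm (((m + 1 : ℕ) : ℝ≥0∞)),
      ENNReal.le_div_iff_mul_le (Or.inl hr0)
        (Or.inl (ENNReal.natCast_ne_top _))]
    -- With q = (r-1)/(m+1) copies the rank fits in r, and r ≤ (q+2)(m+1): the rounding costs at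
    -- most 2n in size, which vanishes after division by r.
    have h1 := mul_le_maxLSize hL hn ((r - 1) / (m + 1))
    have hdm := Nat.div_add_mod (r - 1) (m + 1)
    have hlt := Nat.mod_lt (r - 1) (by omega : 0 < m + 1)
    have h2 : maxLSize ((r - 1) / (m + 1) * (m + 1) + 1) L ≤ maxLSize r L :=
      maxLSize_mono (by rw [mul_comm]; omega)
    have h3 : (((r - 1) / (m + 1) * n : ℕ) : ℝ≥0∞) ≤ ((maxLSize r L : ℕ∞) : ℝ≥0∞) := by
      have := ENat.toENNReal_le.mpr (h1.trans h2)
      simpa using this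
    have h4 : n * r ≤ ((r - 1) / (m + 1) * n + 2 * n) * (m + 1) := by
      have : r ≤ ((r - 1) / (m + 1) + 2) * (m + 1) := by
        rw [add_mul, mul_comm _ (m + 1)]; omega
      calc n * r ≤ n * (((r - 1) / (m + 1) + 2) * (m + 1)) := Nat.mul_le_mul_left n this
        _ = _ := by ring
    calc (n : ℝ≥0∞) * r ≤ ((((r - 1) / (m + 1) * n + 2 * n) * (m + 1) : ℕ) : ℝ≥0∞) := by
          exact_mod_cast h4
      _ = ((((r - 1) / (m + 1) * n : ℕ) : ℝ≥0∞) + ((2 * n : ℕ) : ℝ≥0∞)) *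
          ((m + 1 : ℕ) : ℝ≥0∞) := by push_cast; ring
      _ ≤ _ := by gcongr
  rw [ENNReal.div_le_iff hm0 hmt]
  have hs : ((maxLSize m L : ℕ∞) : ℝ≥0∞) = ⨆ n : ℕ, ⨆ _ : n ∈ {n : ℕ |
      ∃ M : Matrix (Fin n) (Fin n) F, IsLMatrix L M ∧ M.rank ≤ m}, (n : ℝ≥0∞) := by
    simp only [maxLSize, ENat.toENNReal_iSup, ENat.toENNReal_coe]
  rw [hs]
  refine iSup₂_le fun n hn => ?_
  rw [← ENNReal.div_le_iff hm0 hmt]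
  exact key n (le_iSup₂_of_le n hn le_rfl)

lemma exists_tendsto_maxLSize_div :
    ∃ l : ℝ≥0∞, Tendsto (fun r : ℕ => ((maxLSize r L : ℕ∞) : ℝ≥0∞) / (r : ℝ≥0∞)) atTop (𝓝 l) := by
  obtain rfl | hL := L.eq_empty_or_nonempty
  · refine ⟨0, tendsto_of_tendsto_of_tendsto_of_le_of_le tendsto_const_nhds
      (h := fun r : ℕ => (r : ℝ≥0∞)⁻¹) ENNReal.tendsto_inv_nat_nhds_zero
      (fun _ => zero_le) fun r => ?_⟩
    have : ((maxLSize r (∅ : Set F) : ℕ∞) : ℝ≥0∞) ≤ 1 := by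
      simpa using ENat.toENNReal_le.mpr (maxLSize_empty_le (F := F) r)
    calc _ ≤ 1 / (r : ℝ≥0∞) := ENNReal.div_le_div_right this _
      _ = _ := one_div _
  set l := liminf (fun r : ℕ => ((maxLSize r L : ℕ∞) : ℝ≥0∞) / (r : ℝ≥0∞)) atTop with hl
  refine ⟨l, tendsto_of_le_liminf_of_limsup_le le_rfl ?_⟩
  by_cases hlt : l = ⊤
  · rw [hlt]; exact le_top
  have hlim : Tendsto (fun r : ℕ => l * (1 + (r : ℝ≥0∞)⁻¹)) atTop (𝓝 (l * (1 + 0))) :=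
    ENNReal.Tendsto.const_mul (tendsto_const_nhds.add ENNReal.tendsto_inv_nat_nhds_zero)
      (Or.inr hlt)
  rw [add_zero, mul_one] at hlim
  refine (limsup_le_limsup ?_).trans hlim.limsup_eq.le
  filter_upwards [eventually_ge_atTop 1] with r hr
  have hr0 : (r : ℝ≥0∞) ≠ 0 := by exact_mod_cast (by omega : r ≠ 0)
  have h := div_le_liminf_maxLSize_div hL r
  rw [ENNReal.div_le_iff (by exact_mod_cast r.succ_ne_zero) (ENNReal.natCast_ne_top _)] at h
  rw [ENNReal.div_le_iff hr0 (ENNReal.natCast_ne_top _), mul_assoc, add_mul, one_mul,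
    ENNReal.inv_mul_cancel hr0 (ENNReal.natCast_ne_top _)]
  exact_mod_cast h

lemma linear_growth_of_corank_two (hex : ∃ r : ℕ, 1 ≤ r ∧ ((r + 1 : ℕ) : ℕ∞) ≤ maxLSize (r - 1) L) :
    ∃ c : ℝ≥0, 1 < c ∧
      ∀ᶠ r : ℕ in atTop, (c : ℝ≥0∞) * (r : ℝ≥0∞) ≤ ((maxLSize r L : ℕ∞) : ℝ≥0∞) := by
  obtain ⟨r, hr, h⟩ := hex
  have hL : L.Nonempty := by
    by_contra hne
    rw [Set.not_nonempty_iff_eq_empty] at hne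
    subst hne
    have : ((r + 1 : ℕ) : ℕ∞) ≤ (1 : ℕ) := h.trans (maxLSize_empty_le _)
    have : r + 1 ≤ 1 := by exact_mod_cast this
    omega
  obtain ⟨m, rfl⟩ : ∃ m, r = m + 1 := ⟨r - 1, by omega⟩
  simp only [Nat.add_sub_cancel] at h
  have h1 : (1 : ℝ≥0∞) < liminf (fun r : ℕ => ((maxLSize r L : ℕ∞) : ℝ≥0∞) / (r : ℝ≥0∞)) atTop := by
    refine lt_of_lt_of_le ?_ (div_le_liminf_maxLSize_div hL m)
    have h' : ((m + 1 + 1 : ℕ) : ℝ≥0∞) ≤ ((maxLSize m L : ℕ∞) : ℝ≥0∞) := by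
      simpa using ENat.toENNReal_le.mpr h
    rw [ENNReal.lt_div_iff_mul_lt (Or.inl (by exact_mod_cast m.succ_ne_zero))
      (Or.inl (ENNReal.natCast_ne_top _)), one_mul]
    refine lt_of_lt_of_le ?_ h'
    exact_mod_cast Nat.lt_succ_self _
  obtain ⟨c, hc1, hc⟩ := ENNReal.lt_iff_exists_nnreal_btwn.mp h1
  refine ⟨c, by exact_mod_cast hc1, ?_⟩
  filter_upwards [eventually_lt_of_lt_liminf hc] with r hr
  exact ENNReal.mul_le_of_le_div hr.le

lemma corank_two_of_linear_growth (hex : ∃ c : ℝ≥0, 1 < c ∧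
      ∀ᶠ r : ℕ in atTop, (c : ℝ≥0∞) * (r : ℝ≥0∞) ≤ ((maxLSize r L : ℕ∞) : ℝ≥0∞)) :
    ∃ r : ℕ, 1 ≤ r ∧ ((r + 1 : ℕ) : ℕ∞) ≤ maxLSize (r - 1) L := by
  obtain ⟨c, hc, h⟩ := hex
  -- Beyond this threshold cr ≥ r + 2, so N(r) ≥ r + 2.
  obtain ⟨N, hN⟩ := exists_nat_ge (2 / ((c : ℝ) - 1))
  obtain ⟨r, hr, hrN⟩ := (h.and (eventually_ge_atTop N)).exists
  have hc' : (0 : ℝ) < c - 1 := sub_pos.mpr (by exact_mod_cast hc)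
  refine ⟨r + 1, by omega, ?_⟩
  simp only [Nat.add_sub_cancel]
  rw [← ENat.toENNReal_le]
  refine le_trans ?_ hr
  have h2 : ((r + 1 + 1 : ℕ) : ℝ) ≤ c * r := by
    have : 2 / ((c : ℝ) - 1) ≤ r := hN.trans (by exact_mod_cast hrN)
    rw [div_le_iff₀ hc'] at this
    push_cast
    linarith
  have h3 : ((r + 1 + 1 : ℕ) : ℝ≥0) ≤ c * r := by exact_mod_cast h2
  rw [ENat.toENNReal_coe]
  exact_mod_cast h3

end Limit

/-! ### Integer forms obtained from generic determinants. -/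

section Polynomial

open MvPolynomial

lemma Matrix.det_isHomogeneous {σ n : Type*} [Fintype n] [DecidableEq n]
    (A : Matrix n n (MvPolynomial σ ℤ)) (h : ∀ i j, (A i j).IsHomogeneous 1) :
    A.det.IsHomogeneous (Fintype.card n) := by
  rw [Matrix.det_apply]
  refine IsHomogeneous.sum _ _ _ fun s _ => ?_
  have hp : (∏ i, A (s i) i).IsHomogeneous (Fintype.card n) := by
    have := IsHomogeneous.prod Finset.univ (fun i => A (s i) i) (fun _ => 1) fun i _ => h _ _
    simpa using this
  rcases Int.units_eq_one_or (Equiv.Perm.sign s) with hs | hs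
  · simpa [hs] using hp
  · simpa [hs] using hp.neg

lemma MvPolynomial.IsHomogeneous.aeval_mul_left {σ F : Type*} [Field F] {P : MvPolynomial σ ℤ}
    {d : ℕ} (hP : P.IsHomogeneous d) (c : F) (g : σ → F) :
    MvPolynomial.aeval (fun i => c * g i) P = c ^ d * MvPolynomial.aeval g P := by
  rw [aeval_def, aeval_def, eval₂_eq, eval₂_eq, Finset.mul_sum]
  refine Finset.sum_congr rfl fun m hm => ?_
  have hd : ∑ i ∈ m.support, m i = d := by
    rw [← hP (mem_support_iff.mp hm)]
    simp [Finsupp.weight_apply, Finsupp.sum]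
  simp only [mul_pow, Finset.prod_mul_distrib, Finset.prod_pow_eq_pow_sum, hd]
  ring

/-- The matrix is J - I, a rank-one perturbation of -I. -/
lemma Matrix.det_ones_sub_one (n : Type*) [Fintype n] [DecidableEq n] :
    (Matrix.of fun i j : n => if i = j then (0 : ℤ) else 1).det =
      (-1) ^ Fintype.card n * (1 - Fintype.card n) := by
  have h : (Matrix.of fun i j : n => if i = j then (0 : ℤ) else 1) =
      -(1 + (Matrix.replicateCol Unit (fun _ : n => (-1 : ℤ)) *
        Matrix.replicateRow Unit fun _ : n => (1 : ℤ) : Matrix n n ℤ)) := by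
    ext i j
    by_cases hij : i = j <;> simp [hij, Matrix.mul_apply]
  rw [h, Matrix.det_neg, Matrix.det_one_add_replicateCol_mul_replicateRow]
  simp [dotProduct, sub_eq_add_neg]

/-- A singular matrix with zero diagonal and off-diagonal entries among the `α i` gives a form
vanishing at `α`. -/
lemma exists_form_of_det_eq_zero {F : Type*} [Field F] {σ n : Type*} [Fintype n] [DecidableEq n]
    (α : σ → F) (M : Matrix n n F) (hd : ∀ i, M i i = 0)
    (ho : ∀ i j, i ≠ j → M i j ∈ Set.range α) (hM : M.det = 0) :
    ∃ P : MvPolynomial σ ℤ, P.IsHomogeneous (Fintype.card n) ∧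
      eval (fun _ => (1 : ℤ)) P = (-1) ^ Fintype.card n * (1 - Fintype.card n) ∧
      aeval α P = 0 := by
  choose f hf using ho
  let A : Matrix n n (MvPolynomial σ ℤ) :=
    Matrix.of fun i j => if h : i = j then 0 else X (f i j h)
  refine ⟨A.det, Matrix.det_isHomogeneous A fun i j => ?_, ?_, ?_⟩
  · by_cases h : i = j
    · simpa [A, h] using isHomogeneous_zero σ ℤ 1
    · simpa [A, h] using isHomogeneous_X ℤ _
  · rw [RingHom.map_det, ← Matrix.det_ones_sub_one n]
    congr 1
    ext i j
    by_cases h : i = j <;> simp [A, h]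
  · rw [AlgHom.map_det, ← hM]
    congr 1
    ext i j
    by_cases h : i = j
    · subst h; simp [A, hd]
    · simp [A, h, hf]

lemma exists_form_of_coprime {F : Type*} [Field F] {σ : Type*} (α : σ → F)
    (P Q : MvPolynomial σ ℤ) {d e : ℕ} (hd : d ≠ 0) (he : e ≠ 0) (hP : P.IsHomogeneous d)
    (hQ : Q.IsHomogeneous e)
    (hPQ : IsCoprime (eval (fun _ => (1 : ℤ)) P) (eval (fun _ => (1 : ℤ)) Q))
    (hP0 : aeval α P = 0) (hQ0 : aeval α Q = 0) :
    ∃ (R : MvPolynomial σ ℤ) (m : ℕ), R.IsHomogeneous m ∧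
      eval (fun _ => (1 : ℤ)) R = 1 ∧ aeval α R = 0 := by
  -- The powers P^e and Q^d have the common degree de, so their Bézout combination stays
  -- homogeneous.
  obtain ⟨u, v, huv⟩ := (hPQ.pow_left (m := e)).pow_right (n := d)
  refine ⟨C u * P ^ e + C v * Q ^ d, d * e, ?_, ?_, ?_⟩
  · refine IsHomogeneous.add ?_ ?_
    · exact (hP.pow e).C_mul u
    · rw [mul_comm d e]; exact (hQ.pow d).C_mul v
  · simpa using huv
  · simp [hP0, hQ0, hd, he]

end Polynomial

/-! ### From a polynomial relation to a zero-diagonal matrix with a fixed vector. -/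

section Realization

variable {F : Type*} [Field F]

open MvPolynomial in
/-- For `y i ∈ V`, the values of `P` at `1 + y` and at `1` differ by an element of
the non-unital subring generated by `V`. -/
lemma exists_aeval_one_add_sub_mem {σ : Type*} (y : σ → F) (V : Submodule ℤ F)
    (hV : ∀ i, y i ∈ V) (P : MvPolynomial σ ℤ) :
    ∃ n : ℕ, aeval (fun i => 1 + y i) P - ((eval (fun _ => (1 : ℤ)) P : ℤ) : F) ∈
      V * (1 ⊔ V) ^ n := by
  have hmono : ∀ {m n : ℕ}, m ≤ n → V * (1 ⊔ V) ^ m ≤ V * (1 ⊔ V) ^ n := fun h =>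
    mul_le_mul_right (pow_le_pow_right' le_sup_left h) V
  induction P using MvPolynomial.induction_on with
  | C a => exact ⟨0, by simp⟩
  | add p q hp hq =>
    obtain ⟨m, hm⟩ := hp
    obtain ⟨n, hn⟩ := hq
    refine ⟨max m n, ?_⟩
    convert add_mem (hmono (le_max_left m n) hm) (hmono (le_max_right m n) hn) using 1
    simp only [map_add, Int.cast_add]
    ring
  | mul_X p i hp =>
    obtain ⟨n, hn⟩ := hp
    refine ⟨n + 1, ?_⟩
    have hmem : aeval (fun i => 1 + y i) p ∈ (1 ⊔ V) ^ (n + 1) := by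
      rw [← sub_add_cancel (aeval (fun i => 1 + y i) p) ((eval (fun _ => (1 : ℤ)) p : ℤ) : F)]
      refine add_mem ?_ ?_
      · have : V * (1 ⊔ V) ^ n ≤ (1 ⊔ V) ^ (n + 1) := by
          rw [pow_succ']
          exact mul_le_mul_left le_sup_right _
        exact this hn
      · have : (1 : Submodule ℤ F) ≤ (1 ⊔ V) ^ (n + 1) := one_le_pow_of_one_le' le_sup_left _
        refine this (Submodule.mem_one.mpr ⟨eval (fun _ => (1 : ℤ)) p, by simp⟩)
    convert add_mem (hmono (Nat.le_succ n) hn) (Submodule.mul_mem_mul (hV i) hmem) using 1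
    simp only [map_mul, aeval_X, eval_X, mul_one]
    ring

/-- Induction on the exponent: (1+V)^(m+1) = (1+V)^m + V(1+V)^m, and for m ≤ n the last term already
lies in V(1+V)^n. -/
lemma one_sup_pow_le_mul {V : Submodule ℤ F} {n : ℕ}
    (h : (1 : Submodule ℤ F) ≤ V * (1 ⊔ V) ^ n) : (1 ⊔ V) ^ n ≤ V * (1 ⊔ V) ^ n := by
  suffices ∀ m ≤ n, (1 ⊔ V) ^ m ≤ V * (1 ⊔ V) ^ n from this n le_rfl
  intro m
  induction m with
  | zero => intro _; simpa using h
  | succ m ih =>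
    intro hm
    rw [pow_succ', Submodule.sup_mul, one_mul]
    refine sup_le (ih (by omega)) ?_
    exact mul_le_mul_right (pow_le_pow_right' le_sup_left (by omega)) V

lemma exists_sum_mul_of_mem_mul_span {ι : Type*} [Fintype ι] (V : Submodule ℤ F) (e : ι → F)
    {x : F} (hx : x ∈ V * Submodule.span ℤ (Set.range e)) :
    ∃ b : ι → F, (∀ i, b i ∈ V) ∧ ∑ i, b i * e i = x := by
  induction hx using Submodule.mul_induction_on' with
  | mem_mul_mem v hv s hs =>
    obtain ⟨c, rfl⟩ := (Submodule.mem_span_range_iff_exists_fun ℤ).mp hs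
    refine ⟨fun i => c i • v, fun i => V.smul_mem _ hv, ?_⟩
    rw [Finset.mul_sum]
    exact Finset.sum_congr rfl fun i _ => by simp only [zsmul_eq_mul]; ring
  | add x _ y _ hx hy =>
    obtain ⟨b, hb, rfl⟩ := hx
    obtain ⟨c, hc, rfl⟩ := hy
    exact ⟨fun i => b i + c i, fun i => V.add_mem (hb i) (hc i), by
      simp [add_mul, Finset.sum_add_distrib]⟩

lemma List.sum_range_getD {M : Type*} [AddCommMonoid M] (l : List M) {C : ℕ} (h : l.length ≤ C) :
    ∑ c ∈ Finset.range C, l.getD c 0 = l.sum := by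
  induction l generalizing C with
  | nil => simp
  | cons a l ih =>
    obtain ⟨C, rfl⟩ : ∃ D, C = D + 1 := ⟨C - 1, by simp at h; omega⟩
    rw [Finset.sum_range_succ']
    simp only [List.length_cons, add_le_add_iff_right] at h
    simp [← ih h, add_comm]

/-- An element of the additive group generated by `Y ∋ 0` is a difference of two sums of elements
of `Y`, both of any sufficiently large number of terms. -/
lemma exists_sum_sub_sum_of_mem_span {Y : Set F} (h0 : (0 : F) ∈ Y) {b : F}
    (hb : b ∈ Submodule.span ℤ Y) :
    ∃ (p n : ℕ → F) (C₀ : ℕ), (∀ c, p c ∈ Y) ∧ (∀ c, n c ∈ Y) ∧ ∀ C ≥ C₀,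
      ∑ c : Fin C, p c - ∑ c : Fin C, n c = b := by
  have hdiff : ∃ s t : List F, (∀ y ∈ s, y ∈ Y) ∧ (∀ y ∈ t, y ∈ Y) ∧ s.sum - t.sum = b := by
    induction hb using Submodule.span_induction with
    | mem x hx => exact ⟨[x], [], by simpa using hx, by simp, by simp⟩
    | zero => exact ⟨[], [], by simp, by simp, by simp⟩
    | add x y _ _ hx hy =>
      obtain ⟨s, t, hs, ht, rfl⟩ := hx
      obtain ⟨s', t', hs', ht', rfl⟩ := hy
      refine ⟨s ++ s', t ++ t', ?_, ?_, ?_⟩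
      · simpa [or_imp, forall_and] using ⟨hs, hs'⟩
      · simpa [or_imp, forall_and] using ⟨ht, ht'⟩
      · simp only [List.sum_append]; ring
    | smul a x _ hx =>
      obtain ⟨s, t, hs, ht, rfl⟩ := hx
      have hrep : ∀ (k : ℕ) (l : List F), (∀ y ∈ l, y ∈ Y) →
          (∀ y ∈ (List.replicate k l).flatten, y ∈ Y) ∧
          (List.replicate k l).flatten.sum = k * l.sum := fun k l hl => by
        refine ⟨fun y hy => ?_, by simp [List.sum_flatten]⟩
        obtain ⟨m, hm, hy⟩ := List.mem_flatten.mp hy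
        exact hl y (List.eq_of_mem_replicate hm ▸ hy)
      obtain ⟨k, rfl | rfl⟩ := a.eq_nat_or_neg
      · exact ⟨_, _, (hrep k s hs).1, (hrep k t ht).1, by
          rw [(hrep k s hs).2, (hrep k t ht).2]; simp; ring⟩
      · exact ⟨_, _, (hrep k t ht).1, (hrep k s hs).1, by
          rw [(hrep k s hs).2, (hrep k t ht).2]; simp; ring⟩
  obtain ⟨s, t, hs, ht, rfl⟩ := hdiff
  have hget : ∀ l : List F, (∀ y ∈ l, y ∈ Y) → ∀ c, l.getD c 0 ∈ Y := fun l hl c => by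
    by_cases hc : c < l.length
    · rw [List.getD_eq_getElem _ _ hc]; exact hl _ (List.getElem_mem hc)
    · rw [List.getD_eq_default _ _ (by omega)]; exact h0
  refine ⟨fun c => s.getD c 0, fun c => t.getD c 0, max s.length t.length, hget s hs, hget t ht,
    fun C hC => ?_⟩
  rw [Fin.sum_univ_eq_sum_range (fun c => s.getD c 0), Fin.sum_univ_eq_sum_range
    (fun c => t.getD c 0), List.sum_range_getD _ (le_of_max_le_left hC),
    List.sum_range_getD _ (le_of_max_le_right hC)]

/-- A fixed vector of a matrix over the group generated by `Y ∋ 0` yields a fixed vector of a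
(larger) matrix with zero diagonal and entries in `Y`. -/
lemma exists_zero_diag_fixed_vector {ι : Type} [Fintype ι] {Y : Set F} (h0 : (0 : F) ∈ Y)
    (b : Matrix ι ι F) (hb : ∀ i j, b i j ∈ Submodule.span ℤ Y) {v : ι → F} (hv : v ≠ 0)
    (hbv : b.mulVec v = v) :
    ∃ (κ : Type) (_ : Fintype κ) (B : Matrix κ κ F) (w : κ → F), (∀ i, B i i = 0) ∧
      (∀ i j, B i j ∈ Y) ∧ w ≠ 0 ∧ B.mulVec w = w := by
  choose p n C₀ hp hn hC using fun i j => exists_sum_sub_sum_of_mem_span h0 (hb i j)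
  obtain ⟨C, hCC⟩ : ∃ C, ∀ i j, C₀ i j ≤ C :=
    ⟨∑ i, ∑ j, C₀ i j, fun i j =>
      (Finset.single_le_sum (f := fun j => C₀ i j) (fun _ _ => Nat.zero_le _)
        (Finset.mem_univ j)).trans
      (Finset.single_le_sum (f := fun i => ∑ j, C₀ i j) (fun _ _ => Nat.zero_le _)
        (Finset.mem_univ i))⟩
  -- Each index is split into D copies with a sign bit and a colour bit. Only entries between
  -- different colours are nonzero, which clears the diagonal; the sign bit, through ±v, turns the
  -- terms `n` into subtractions. The extra 1 makes `Fin D` nonempty, so `w` is nonzero.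
  let D := C + 1
  let B : Matrix (ι × Fin D × Bool × Bool) (ι × Fin D × Bool × Bool) F := Matrix.of fun x z =>
    if x.2.2.2 = z.2.2.2 then 0 else
      if x.2.2.1 = z.2.2.1 then p x.1 z.1 z.2.1 else n x.1 z.1 z.2.1
  let w : ι × Fin D × Bool × Bool → F := fun x => if x.2.2.1 then v x.1 else - v x.1
  refine ⟨ι × Fin D × Bool × Bool, inferInstance, B, w, fun i => by simp [B], fun i j => ?_, ?_, ?_⟩
  · simp only [B, Matrix.of_apply]
    split_ifs
    exacts [h0, hp _ _ _, hn _ _ _]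
  · obtain ⟨i, hi⟩ := Function.ne_iff.mp hv
    exact Function.ne_iff.mpr ⟨(i, 0, true, true), by simpa [w] using hi⟩
  · ext ⟨i, c, s, e⟩
    have hsum : ∑ j, b i j * v j = v i := congrFun hbv i
    have hD : ∀ j, ∑ c : Fin D, p i j c - ∑ c : Fin D, n i j c = b i j := fun j =>
      hC i j D ((hCC i j).trans (Nat.le_succ C))
    have hsum' : ∑ j, ((∑ c : Fin D, p i j c) * v j - (∑ c : Fin D, n i j c) * v j) = v i := by
      rw [← hsum]
      exact Finset.sum_congr rfl fun j _ => by rw [← sub_mul, hD]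
    simp only [Matrix.mulVec, dotProduct, Fintype.sum_prod_type, Fintype.sum_bool, B, w,
      Matrix.of_apply]
    cases s <;> cases e <;>
      simp [Finset.sum_add_distrib, ← Finset.sum_mul] <;>
      rw [← hsum'] <;> simp [Finset.sum_sub_distrib] <;> ring

end Realization

/-! ### The equivalence of corank 2 with the existence of a form. -/

section Equivalence

variable {F : Type*} [Field F]

open MvPolynomial in
lemma exists_form_of_corank_two {σ : Type*} (α : σ → F)
    (hex : ∃ r : ℕ, 1 ≤ r ∧ ((r + 1 : ℕ) : ℕ∞) ≤ maxLSize (r - 1) (Set.range α)) :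
    ∃ (P : MvPolynomial σ ℤ) (d : ℕ), P.IsHomogeneous d ∧
      eval (fun _ => (1 : ℤ)) P = 1 ∧ aeval α P = 0 := by
  obtain ⟨r, hr, h⟩ := hex
  obtain ⟨m, rfl⟩ : ∃ m, r = m + 1 := ⟨r - 1, by omega⟩
  obtain ⟨M, ⟨hd, ho⟩, hM⟩ := exists_isLMatrix_of_le_maxLSize h
  simp only [Nat.add_sub_cancel] at hM
  obtain ⟨P, hP, hP1, hP0⟩ := exists_form_of_det_eq_zero α M hd ho
    (Matrix.det_eq_zero_of_rank_lt M (by rw [Fintype.card_fin]; omega))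
  obtain ⟨Q, hQ, hQ1, hQ0⟩ := exists_form_of_det_eq_zero α (M.submatrix Fin.succ Fin.succ)
    (fun i => hd _) (fun i j hij => ho _ _ ((Fin.succ_injective _).ne hij))
    (Matrix.det_eq_zero_of_rank_lt _ (by
      rw [Fintype.card_fin]
      exact Nat.lt_succ_of_le ((Matrix.rank_submatrix_le M _ _).trans hM)))
  simp only [Fintype.card_fin] at hP hP1 hQ hQ1
  refine exists_form_of_coprime α P Q (by omega) (by omega) hP hQ ?_ hP0 hQ0
  rw [hP1, hQ1]
  refine ⟨-(-1) ^ (m + 1 + 1), (-1) ^ (m + 1), ?_⟩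
  have hsq : ∀ k : ℕ, ((-1 : ℤ) ^ k) * (-1) ^ k = 1 := fun k => by rw [← mul_pow]; simp
  have h1 := hsq (m + 1 + 1)
  have h2 := hsq (m + 1)
  push_cast
  linear_combination (m + 1 : ℤ) * h1 - (m : ℤ) * h2

open MvPolynomial in
lemma exists_zero_diag_fixed_vector_of_form {σ : Type*} [Finite σ] (y : σ → F)
    (P : MvPolynomial σ ℤ) (h1 : eval (fun _ => (1 : ℤ)) P = 1)
    (h0 : aeval (fun i => 1 + y i) P = 0) :
    ∃ (κ : Type) (_ : Fintype κ) (B : Matrix κ κ F) (w : κ → F), (∀ i, B i i = 0) ∧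
      (∀ i j, B i j ∈ insert 0 (Set.range y)) ∧ w ≠ 0 ∧ B.mulVec w = w := by
  set Y : Set F := insert 0 (Set.range y) with hY
  set V : Submodule ℤ F := Submodule.span ℤ Y with hV
  have hfg : V.FG := Submodule.fg_span ((Set.finite_range y).insert 0)
  obtain ⟨n, hn⟩ := exists_aeval_one_add_sub_mem y V
    (fun i => Submodule.subset_span (Set.mem_insert_of_mem _ ⟨i, rfl⟩)) P
  rw [h0, h1, Int.cast_one, zero_sub, Submodule.neg_mem_iff] at hn
  have hle := one_sup_pow_le_mul (Submodule.one_le.mpr hn)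
  have hfgS : ((1 ⊔ V) ^ n).FG :=
    (Submodule.FG.sup ⟨{1}, by rw [Finset.coe_singleton, ← Submodule.one_eq_span]⟩ hfg).pow n
  obtain ⟨N, e, he⟩ := Submodule.fg_iff_exists_fin_generating_family.mp hfgS
  have hrow : ∀ i, ∃ b : Fin N → F, (∀ j, b j ∈ V) ∧ ∑ j, b j * e j = e i := fun i => by
    refine exists_sum_mul_of_mem_mul_span V e ?_
    rw [he]
    exact hle (he ▸ Submodule.subset_span ⟨i, rfl⟩)
  choose b hb hbe using hrow
  refine exists_zero_diag_fixed_vector (Set.mem_insert 0 _) (Matrix.of b) hb (v := e) ?_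
    (funext hbe)
  rintro rfl
  have hone : (1 : F) ∈ (1 ⊔ V) ^ n :=
    Submodule.one_le.mp (one_le_pow_of_one_le' le_sup_left n)
  rw [← he] at hone
  have hz : Submodule.span ℤ (Set.range (0 : Fin N → F)) = ⊥ := by
    rw [Submodule.span_eq_bot]
    rintro _ ⟨i, rfl⟩
    rfl
  rw [hz] at hone
  exact one_ne_zero ((Submodule.mem_bot ℤ).mp hone)

open MvPolynomial in
lemma corank_two_of_exists_form {σ : Type*} [Finite σ] (α : σ → F) (hα : ∀ i, α i ≠ 0)
    (P : MvPolynomial σ ℤ) (d : ℕ) (hP : P.IsHomogeneous d)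
    (h1 : eval (fun _ => (1 : ℤ)) P = 1) (h0 : aeval α P = 0) :
    ∃ r : ℕ, 1 ≤ r ∧ ((r + 1 : ℕ) : ℕ∞) ≤ maxLSize (r - 1) (Set.range α) := by
  classical
  obtain hσ | ⟨⟨i₀⟩⟩ := isEmpty_or_nonempty σ
  · rw [eq_C_of_isEmpty P, eval_C] at h1
    rw [eq_C_of_isEmpty P, h1] at h0
    simp at h0
  set a := α i₀ with ha
  have ha0 : a ≠ 0 := hα i₀
  have hshift : aeval (fun i => 1 + (α i / a - 1)) P = 0 := by
    have : (fun i => 1 + (α i / a - 1)) = fun i => a⁻¹ * α i := by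
      ext i; ring
    rw [this, hP.aeval_mul_left, h0, mul_zero]
  obtain ⟨κ, _, B, w, hBd, hBY, hw, hBw⟩ := exists_zero_diag_fixed_vector_of_form _ P h1 hshift
  set A : Matrix κ κ F := Matrix.of fun i j => if i = j then 0 else a * (1 + B i j) with hA
  have hAd : ∀ i, A i i = 0 := fun i => by simp [hA]
  have hAo : ∀ i j, i ≠ j → A i j ∈ Set.range α := fun i j hij => by
    simp only [hA, Matrix.of_apply, if_neg hij]
    obtain h | ⟨l, h⟩ := hBY i j
    · exact ⟨i₀, by rw [h, add_zero, mul_one]⟩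
    · refine ⟨l, ?_⟩
      rw [← h]
      field_simp
      ring
  have hAB : A - (Matrix.of fun _ _ => a) = a • (B - 1) := by
    ext i j
    by_cases h : i = j
    · subst h; simp [hA, hBd]
    · simp [hA, h]; ring
  have hrank : (A - (Matrix.of fun _ _ => a)).rank < Fintype.card κ := by
    refine Matrix.rank_lt_card_of_mulVec_eq_zero _ hw ?_
    rw [hAB, Matrix.smul_mulVec, Matrix.sub_mulVec, hBw, Matrix.one_mulVec, sub_self, smul_zero]
  -- Each copy saves one in rank and adding aJ costs one overall, so three copies have corank at
  -- least 3 - 1 = 2.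
  have hmul := mul_card_le_maxLSize (L := Set.range α) ⟨i₀, rfl⟩ A hAd hAo
    (Nat.le_pred_of_lt hrank) 3
  refine ⟨3 * Fintype.card κ - 1, by omega, ?_⟩
  have e1 : 3 * Fintype.card κ - 1 + 1 = 3 * Fintype.card κ := by omega
  have e2 : 3 * (Fintype.card κ).pred + 1 = 3 * Fintype.card κ - 1 - 1 := by
    rw [Nat.pred_eq_sub_one]; omega
  rwa [e1, ← e2]

end Equivalence

theorem mainTheorem2 {F : Type*} [Field F] (k : ℕ) (α : Fin k → F) (L : Set F)
    (hL : L = Set.range α) (h0 : (0 : F) ∉ L) :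
    List.TFAE [
      ∃ r : ℕ, 1 ≤ r ∧ ((r + 1 : ℕ) : ℕ∞) ≤ maxLSize (r - 1) L,
      ∃ (P : MvPolynomial (Fin k) ℤ) (d : ℕ), P.IsHomogeneous d ∧
        MvPolynomial.eval (fun _ => (1 : ℤ)) P = 1 ∧ MvPolynomial.aeval α P = 0,
      ∃ c : ℝ≥0, 1 < c ∧
        ∀ᶠ r : ℕ in atTop, (c : ℝ≥0∞) * (r : ℝ≥0∞) ≤ ((maxLSize r L : ℕ∞) : ℝ≥0∞)] ∧
    ∃ l : ℝ≥0∞,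
      Tendsto (fun r : ℕ => ((maxLSize r L : ℕ∞) : ℝ≥0∞) / (r : ℝ≥0∞)) atTop (𝓝 l) := by
  subst hL
  refine ⟨?_, exists_tendsto_maxLSize_div⟩
  tfae_have 1 → 2 := exists_form_of_corank_two α
  tfae_have 2 → 1 := fun ⟨P, d, hP, h1, hα⟩ =>
    corank_two_of_exists_form α (fun i hi => h0 ⟨i, hi⟩) P d hP h1 hα
  tfae_have 1 → 3 := linear_growth_of_corank_two
  tfae_have 3 → 1 := corank_two_of_linear_growth
  tfae_finish
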